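/- Let $\mathcal H$ be a separable complex Hilbert space and let $q$ be a positive semi-definite sesquilinear form with dense form domain $\mathrm{Dom}\,q\subseteq\mathcal H$. Conventions. Inner products and forms are conjugate-linear in the first variable. For densely defined positive semi-definite forms, $p\le q$ means that $\mathrm{Dom}\,q\subseteq\mathrm{Dom}\,p$ and $p(x,x)\le q(x,x)$ for all $x\in\mathrm{Dom}\,q$. A form $q$ is closed if $\mathrm{Dom}\,q$ is complete for the inner product $\langle x,y\rangle_{\mathcal H}+q(x,y)$, and closeable if it has a closed extension; the closure of a closeable form is its smallest closed extension. The absolutely continuous part $q_{ac}$ of $q$ is the largest closeable form $\le q$. The form of a (densely defined, possibly unbounded) positive semi-definite self-adjoint operator $T$ is $q_T(x,y)=\langle\sqrt T x,\sqrt T y\rangle_{\mathcal H}$ with $\mathrm{Dom}\,q_T=\mathrm{Dom}\,\sqrt T$, where $\sqrt T$ is the positive semi-definite self-adjoint square root of $T$. Finally, $\hat{\mathcal H}(q)$ is the Hilbert space completion of $\mathrm{Dom}\,q$ with respect to the inner product $\langle x,y\rangle_{\mathcal H}+q(x,y)$, $\mathrm j_q:\mathrm{Dom}\,q\to\hat{\mathcal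 H}(q)$ is the canonical embedding, and the co-embedding $E_q:\hat{\mathcal H}(q)\to\mathcal H$ is the continuous extension of the map $\mathrm j_q(x)\mapsto x$. Theorem. There is exactly one positive semi-definite self-adjoint operator $T$ in $\mathcal H$ whose form $q_T$ is the closure $\overline{q_{ac}}$ of the absolutely continuous part of $q$. The co-embedding $E_q$ is a contraction, $\|E_q\|\le 1$. Moreover, for this $T$, $$(I+T)^{-1}=E_qE_q^*,$$ that is, $I+T:\mathrm{Dom}\,T\to\mathcal H$ is a bijection whose inverse is the everywhere defined bounded operator $E_qE_q^*$. -/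

import Mathlib

/-- A densely defined, positive semi-definite sesquilinear form in `H`, with form domain `domain`
(conjugate-linear in the first variable, linear in the second). -/
structure PosForm (H : Type*) [NormedAddCommGroup H] [InnerProductSpace ℂ H] where
  /-- the form domain -/
  domain : Submodule ℂ H
  /-- the form domain is dense -/
  dense : Dense (domain : Set H)
  /-- the sesquilinear form -/
  form : domain →ₗ⋆[ℂ] domain →ₗ[ℂ] ℂ
  /-- `form x x` is real -/
  im_self : ∀ x, (form x x).im = 0
  /-- `form x x` is nonnegative -/
  re_self_nonneg : ∀ x, 0 ≤ (form x x).re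

namespace PosForm

variable {H : Type*} [NormedAddCommGroup H] [InnerProductSpace ℂ H]

/-- Positive semi-definite complex sesquilinear forms are Hermitian (polarization). -/
theorem conj_form (q : PosForm H) (x y : q.domain) :
    (starRingEnd ℂ) (q.form y x) = q.form x y := by
  have h1 := q.im_self (x + y)
  have h2 := q.im_self (x + Complex.I • y)
  have hx := q.im_self x
  have hy := q.im_self y
  simp only [map_add, LinearMap.add_apply, LinearMap.map_smulₛₗ, LinearMap.smul_apply,
    smul_eq_mul, Complex.conj_I, Complex.add_im, Complex.add_re, Complex.mul_im, Complex.mul_re,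
    Complex.I_re, Complex.I_im, Complex.neg_re, Complex.neg_im, RingHom.id_apply] at h1 h2
  apply Complex.ext
  · simp only [Complex.conj_re]
    linarith
  · simp only [Complex.conj_im]
    linarith

/-- The form domain of `q`, regarded as an inner product space with the inner product
`⟪x, y⟫_H + q (x, y)`. -/
def FormSpace (q : PosForm H) : Type _ := q.domain

instance (q : PosForm H) : AddCommGroup q.FormSpace := inferInstanceAs (AddCommGroup q.domain)

instance (q : PosForm H) : Module ℂ q.FormSpace := inferInstanceAs (Module ℂ q.domain)

/-- The inner product `⟪x, y⟫_H + q (x, y)` on the form domain. -/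
@[reducible] noncomputable def core (q : PosForm H) : InnerProductSpace.Core ℂ q.FormSpace where
  inner := fun (x y : q.domain) => inner ℂ (x : H) (y : H) + q.form x y
  conj_inner_symm := fun (x y : q.domain) => by
    change (starRingEnd ℂ) (inner ℂ (y : H) (x : H) + q.form y x) = _
    rw [map_add, inner_conj_symm, q.conj_form]
  re_inner_nonneg := fun (x : q.domain) => by
    change 0 ≤ (inner ℂ (x : H) (x : H) + q.form x x).re
    rw [Complex.add_re]
    exact add_nonneg (inner_self_nonneg (𝕜 := ℂ) (x := (x : H))) (q.re_self_nonneg x)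
  add_left := fun (x y z : q.domain) => by
    change inner ℂ ((x : H) + (y : H)) (z : H) + q.form (x + y) z =
      (inner ℂ (x : H) (z : H) + q.form x z) + (inner ℂ (y : H) (z : H) + q.form y z)
    rw [inner_add_left, map_add, LinearMap.add_apply]
    ring
  smul_left := fun (x y : q.domain) r => by
    change inner ℂ (r • (x : H)) (y : H) + q.form (r • x) y =
      (starRingEnd ℂ) r * (inner ℂ (x : H) (y : H) + q.form x y)
    rw [inner_smul_left, LinearMap.map_smulₛₗ, LinearMap.smul_apply, smul_eq_mul]
    ring
  definite := fun (x : q.domain) h => by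
    change inner ℂ (x : H) (x : H) + q.form x x = 0 at h
    have h1 := congrArg Complex.re h
    rw [Complex.add_re, Complex.zero_re] at h1
    have h2 : 0 ≤ (inner ℂ (x : H) (x : H)).re := inner_self_nonneg (𝕜 := ℂ) (x := (x : H))
    have h3 : (inner ℂ (x : H) (x : H)).re = 0 := by linarith [q.re_self_nonneg x]
    have h4 : (x : H) = 0 := by
      rw [← norm_eq_zero, ← sq_eq_zero_iff, ← inner_self_eq_norm_sq (𝕜 := ℂ)]
      exact h3
    exact Subtype.ext h4

noncomputable instance (q : PosForm H) : NormedAddCommGroup q.FormSpace :=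
  q.core.toNormedAddCommGroup

noncomputable instance (q : PosForm H) : InnerProductSpace ℂ q.FormSpace :=
  InnerProductSpace.ofCore q.core.toCore

/-- The inner product of `q.FormSpace` is `⟪x, y⟫_H + q (x, y)`. -/
theorem formSpace_inner (q : PosForm H) (x y : q.domain) :
    inner ℂ (show q.FormSpace from x) (show q.FormSpace from y) =
      inner ℂ (x : H) (y : H) + q.form x y := rfl

/-- `Ĥ(q)`: the Hilbert space completion of the form domain with respect to
`⟪x, y⟫_H + q (x, y)`. -/
abbrev FormCompletion (q : PosForm H) : Type _ := UniformSpace.Completion q.FormSpace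

/-- The formal embedding `j_q` of the form domain into `Ĥ(q)`. -/
noncomputable def embed (q : PosForm H) (x : q.domain) : q.FormCompletion :=
  ((show q.FormSpace from x : q.FormSpace) : UniformSpace.Completion q.FormSpace)

/-- The inclusion of the form domain in `H`, as a linear map on `q.FormSpace`. -/
def inclusionₗ (q : PosForm H) : q.FormSpace →ₗ[ℂ] H := q.domain.subtype

/-- The inclusion of the form domain in `H` is contractive for the form norm. -/
theorem norm_inclusionₗ_le (q : PosForm H) (x : q.FormSpace) :
    ‖q.inclusionₗ x‖ ≤ 1 * ‖x‖ := by
  rw [one_mul]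
  refine le_of_sq_le_sq ?_ (norm_nonneg _)
  have h1 : ‖x‖ ^ 2 = RCLike.re (inner ℂ x x) := (inner_self_eq_norm_sq (𝕜 := ℂ) x).symm
  have h2 : ‖q.inclusionₗ x‖ ^ 2 = RCLike.re (inner ℂ (q.inclusionₗ x) (q.inclusionₗ x)) :=
    (inner_self_eq_norm_sq (𝕜 := ℂ) _).symm
  rw [h1, h2]
  exact le_add_of_nonneg_right (q.re_self_nonneg x)

/-- The inclusion of the form domain (with the form norm) in `H`, a contraction. -/
noncomputable def inclusion (q : PosForm H) : q.FormSpace →L[ℂ] H :=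
  q.inclusionₗ.mkContinuous 1 q.norm_inclusionₗ_le

/-- The co-embedding `E_q : Ĥ(q) → H`: the continuous extension of `j_q x ↦ x`. -/
noncomputable def coEmbedding [CompleteSpace H] (q : PosForm H) : q.FormCompletion →L[ℂ] H :=
  q.inclusion.extend (UniformSpace.Completion.toComplL (𝕜 := ℂ) (E := q.FormSpace))

/-- The defining property `E_q (j_q x) = x`. -/
theorem coEmbedding_embed [CompleteSpace H] (q : PosForm H) (x : q.domain) :
    q.coEmbedding (q.embed x) = x :=
  ContinuousLinearMap.extend_eq q.inclusion
    (UniformSpace.Completion.denseRange_coe (α := q.FormSpace))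
    (UniformSpace.Completion.isUniformInducing_coe q.FormSpace) x

/-- The (Kato, Simon) order on forms: `p ≤ q` if `Dom q ⊆ Dom p` and `p (x, x) ≤ q (x, x)` for all
`x ∈ Dom q`. -/
instance : LE (PosForm H) where
  le p q := ∃ h : q.domain ≤ p.domain, ∀ x : q.domain,
    (p.form ⟨x, h x.2⟩ ⟨x, h x.2⟩).re ≤ (q.form x x).re

/-- `p` is an extension of `q`. -/
def IsExtension (p q : PosForm H) : Prop :=
  ∃ h : q.domain ≤ p.domain, ∀ x y : q.domain,
    p.form ⟨x, h x.2⟩ ⟨y, h y.2⟩ = q.form x y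

/-- A form is closed if its domain is complete for the inner product `⟪x, y⟫_H + q (x, y)`. -/
def IsClosed (q : PosForm H) : Prop := CompleteSpace q.FormSpace

/-- A form is closeable (absolutely continuous) if it has a closed extension. -/
def IsCloseable (q : PosForm H) : Prop := ∃ p : PosForm H, p.IsClosed ∧ p.IsExtension q

/-- `p` is the closure of `q`: the smallest closed extension of `q`. -/
def IsClosureOf (p q : PosForm H) : Prop :=
  p.IsClosed ∧ p.IsExtension q ∧ ∀ r : PosForm H, r.IsClosed → r.IsExtension q → r.IsExtension p

/-- `p` is the absolutely continuous part of `q`: the largest closeable form below `q`. -/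
def IsACPartOf (p q : PosForm H) : Prop := IsGreatest {r : PosForm H | r.IsCloseable ∧ r ≤ q} p

end PosForm

namespace LinearPMap

variable {H : Type*} [NormedAddCommGroup H] [InnerProductSpace ℂ H]

/-- `T` is a (densely defined, possibly unbounded) positive semi-definite self-adjoint operator. -/
def IsPosSelfAdjoint [CompleteSpace H] (T : H →ₗ.[ℂ] H) : Prop :=
  IsSelfAdjoint T ∧ ∀ x : T.domain, 0 ≤ (inner ℂ (x : H) (T x)).re

/-- `S` is the positive square root of `T`: `S` is positive self-adjoint and `T = S ∘ S`, where
`Dom (S ∘ S) = {x ∈ Dom S | S x ∈ Dom S}`. -/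
def IsPosSqrtOf [CompleteSpace H] (S T : H →ₗ.[ℂ] H) : Prop :=
  S.IsPosSelfAdjoint ∧
    ∀ x y : H, (x, y) ∈ T.graph ↔ ∃ z : H, (x, z) ∈ S.graph ∧ (z, y) ∈ S.graph

/-- `A : Dom A → H` is bijective, with everywhere defined bounded inverse `A⁻¹ = B`. -/
def HasBoundedInverse (A : H →ₗ.[ℂ] H) (B : H →L[ℂ] H) : Prop :=
  (∀ x : A.domain, B (A x) = x) ∧ ∀ y : H, ∃ h : B y ∈ A.domain, A ⟨B y, h⟩ = y

end LinearPMap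

/-- `q = q_T` is the form of the positive self-adjoint operator `T`: `Dom q = Dom √T` and
`q (x, y) = ⟪√T x, √T y⟫`. -/
def PosForm.IsFormOf {H : Type*} [NormedAddCommGroup H] [InnerProductSpace ℂ H] [CompleteSpace H]
    (q : PosForm H) (T : H →ₗ.[ℂ] H) : Prop :=
  T.IsPosSelfAdjoint ∧ ∃ S : H →ₗ.[ℂ] H, S.IsPosSqrtOf T ∧
    ∃ h : q.domain = S.domain, ∀ x y : q.domain,
      q.form x y = inner ℂ (S ⟨x, h.le x.2⟩) (S ⟨y, h.le y.2⟩)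

/-!
The restriction `J` of the co-embedding `E_q` to `(ker E_q)ᗮ` is an injective contraction with dense
range, so `⟪J⁻¹ x, J⁻¹ y⟫ - ⟪x, y⟫` is a closed form on the range of `E_q`. It is the largest closed
form below `q`, because `E_q` factors contractively through the form space of every closed `s ≤ q`.
Hence its restriction to `Dom q` is `q_ac`, and it is the closure of `q_ac` because `j_q (Dom q)` is
dense in `Ĥ(q)`. On the other hand `E_q E_q† = J J†`, and the polar decomposition
`J† = U √(J J†)` turns `⟪J⁻¹ x, J⁻¹ y⟫` into `⟪(J J†)^(-1/2) x, (J J†)^(-1/2) y⟫`. So the form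
belongs to `T = (1 - J J†) (J J†)⁻¹`, that is, `(1 + T)⁻¹ = E_q E_q†`.
-/

open scoped InnerProductSpace InnerProduct
open Function ContinuousLinearMap UniformSpace

section CStarAlgebra

variable {A : Type*} [CStarAlgebra A] [PartialOrder A] [StarOrderedRing A]

theorem commute_sqrt_sqrt_one_sub (a : A) : Commute (CFC.sqrt a) (CFC.sqrt (1 - a)) := by
  simp only [CFC.sqrt_eq_cfc]
  have ha : Commute a (1 - a) := (Commute.one_right a).sub_right (Commute.refl a)
  exact ((ha.cfc_nnreal _).symm.cfc_nnreal _).symm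

theorem isUnit_add_of_mul_self_add_mul_self_eq_one {a b : A} (ha : 0 ≤ a) (hb : 0 ≤ b)
    (hab : Commute a b) (h : a * a + b * b = 1) : IsUnit (a + b) := by
  have hsq : (a + b) ^ 2 = 1 + 2 • (a * b) := by
    rw [← h, hab.add_sq]
    noncomm_ring
  have hle : 1 ≤ (a + b) ^ 2 :=
    hsq ▸ le_add_of_nonneg_right (nsmul_nonneg (hab.mul_nonneg ha hb) 2)
  exact (isUnit_pow_iff two_ne_zero).1 (CStarAlgebra.isUnit_of_le 1 hle)

end CStarAlgebra

section Adjoint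

variable {𝕜 G H : Type*} [RCLike 𝕜]
  [NormedAddCommGroup G] [InnerProductSpace 𝕜 G] [CompleteSpace G]
  [NormedAddCommGroup H] [InnerProductSpace 𝕜 H] [CompleteSpace H]

theorem denseRange_iff_injective_adjoint {E : G →L[𝕜] H} : DenseRange E ↔ Injective (E†) := by
  change Dense (E.range : Set H) ↔ _
  rw [Submodule.dense_iff_topologicalClosure_eq_top, Submodule.topologicalClosure_eq_top_iff,
    orthogonal_range]
  exact LinearMap.ker_eq_bot

theorem denseRange_of_isSelfAdjoint_of_injective {C : H →L[𝕜] H} (hC : IsSelfAdjoint C)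
    (hinj : Injective C) : DenseRange C :=
  denseRange_iff_injective_adjoint.2 (hC.adjoint_eq.symm ▸ hinj)

theorem injective_self_comp_adjoint {E : G →L[𝕜] H} (hE : DenseRange E) :
    Injective (E ∘L E†) := by
  refine LinearMap.ker_eq_bot.1 ?_
  rw [ker_self_comp_adjoint]
  exact LinearMap.ker_eq_bot.2 (denseRange_iff_injective_adjoint.1 hE)

theorem self_comp_adjoint_nonneg (E : G →L[𝕜] H) : 0 ≤ E ∘L E† :=
  (nonneg_iff_isPositive _).2 (isPositive_self_comp_adjoint E)

theorem mem_graph_iff_of_isSelfAdjoint {T : H →ₗ.[𝕜] H} (hT : IsSelfAdjoint T) {x y : H} :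
    (x, y) ∈ T.graph ↔ ∀ z : T.domain, ⟪T z, x⟫_𝕜 = ⟪(z : H), y⟫_𝕜 := by
  have hgraph : T.graph.adjoint = T.graph := by
    rw [← LinearPMap.adjoint_graph_eq_graph_adjoint hT.dense_domain,
      LinearPMap.isSelfAdjoint_def.1 hT]
  rw [← hgraph, Submodule.mem_adjoint_iff]
  simp [LinearPMap.mem_graph_iff, sub_eq_zero]

/-- `U` is the unitary factor of the polar decomposition `J† = U C`, where `C = √(J J†)`. -/
theorem exists_linearIsometryEquiv_comp_eq {J : G →L[𝕜] H} {C : H →L[𝕜] H} (hinj : Injective J)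
    (hdense : DenseRange J) (hC : IsSelfAdjoint C) (hCC : C * C = J ∘L J†) :
    ∃ U : H ≃ₗᵢ[𝕜] G, ∀ z, J (U z) = C z := by
  have hC_inj : Injective C :=
    .of_comp (f := C) (hCC ▸ injective_self_comp_adjoint hdense : Injective ⇑(C * C))
  have hC_dense := denseRange_of_isSelfAdjoint_of_injective hC hC_inj
  have hJ_dense : DenseRange (J†) :=
    denseRange_iff_injective_adjoint.2 ((adjoint_adjoint J).symm ▸ hinj)
  have hnorm (y : H) : ‖(J†) y‖ = ‖C y‖ := by
    rw [← sq_eq_sq₀ (norm_nonneg _) (norm_nonneg _), apply_norm_sq_eq_inner_adjoint_left,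
      apply_norm_sq_eq_inner_adjoint_left, adjoint_adjoint, hC.adjoint_eq, ← hCC]
    rfl
  obtain ⟨U, hU⟩ : ∃ U : H ≃ₗᵢ[𝕜] G, ∀ y, U (C y) = (J†) y :=
    ⟨_, LinearEquiv.extendOfIsometry_eq (LinearEquiv.refl 𝕜 H) (C : H →ₗ[𝕜] H)
      (J† : H →ₗ[𝕜] G) hC_dense hJ_dense hnorm⟩
  refine ⟨U, fun z => ?_⟩
  refine hC_dense.induction_on z (isClosed_eq (by fun_prop) (by fun_prop)) fun y => ?_
  rw [hU]
  exact congr($hCC y).symm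

end Adjoint

theorem self_comp_adjoint_le_one {G H : Type*}
    [NormedAddCommGroup G] [InnerProductSpace ℂ G] [CompleteSpace G]
    [NormedAddCommGroup H] [InnerProductSpace ℂ H] [CompleteSpace H]
    {E : G →L[ℂ] H} (hE : ‖E‖ ≤ 1) : E ∘L E† ≤ 1 := by
  refine (CStarAlgebra.norm_le_one_iff_of_nonneg _ (self_comp_adjoint_nonneg E)).1 ?_
  refine (opNorm_comp_le _ _).trans ?_
  rw [LinearIsometryEquiv.norm_map]
  exact mul_le_one₀ hE (norm_nonneg _) hE

section InjectivePart

variable {𝕜 G H : Type*} [RCLike 𝕜] [NormedAddCommGroup G] [InnerProductSpace 𝕜 G]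
  [NormedAddCommGroup H] [InnerProductSpace 𝕜 H]

/-- The restriction of `E` to the orthogonal complement of its kernel. -/
noncomputable def injectivePart (E : G →L[𝕜] H) : E.kerᗮ →L[𝕜] H :=
  E ∘L E.kerᗮ.subtypeL

theorem injective_injectivePart (E : G →L[𝕜] H) : Injective (injectivePart E) :=
  (injective_iff_map_eq_zero _).2 fun u hu =>
    Subtype.ext (Submodule.disjoint_def.1 E.ker.orthogonal_disjoint u hu u.2)

theorem norm_injectivePart_le (E : G →L[𝕜] H) : ‖injectivePart E‖ ≤ ‖E‖ :=
  (opNorm_comp_le _ _).trans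
    (mul_le_of_le_one_right (norm_nonneg _) (Submodule.norm_subtypeL_le _))

variable [CompleteSpace G]

theorem injectivePart_orthogonalProjectionOnto (E : G →L[𝕜] H) (u : G) :
    injectivePart E (E.kerᗮ.orthogonalProjectionOnto u) = E u := by
  have : CompleteSpace E.ker := E.isClosed_ker.completeSpace_coe
  have hker : E (u - E.kerᗮ.starProjection u) = 0 := by
    have hmem := E.kerᗮ.sub_starProjection_mem_orthogonal u
    rwa [Submodule.orthogonal_orthogonal] at hmem
  rw [map_sub, sub_eq_zero] at hker
  exact hker.symm

theorem denseRange_injectivePart {E : G →L[𝕜] H} (hE : DenseRange E) :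
    DenseRange (injectivePart E) := by
  refine Dense.mono ?_ hE
  rintro _ ⟨u, rfl⟩
  exact ⟨_, injectivePart_orthogonalProjectionOnto E u⟩

variable [CompleteSpace H]

theorem injectivePart_comp_adjoint (E : G →L[𝕜] H) :
    injectivePart E ∘L (injectivePart E)† = E ∘L E† := by
  ext y
  simp only [injectivePart, adjoint_comp, Submodule.adjoint_subtypeL]
  exact injectivePart_orthogonalProjectionOnto E ((E†) y)

end InjectivePart

section OperatorQuotient

section Ring

variable {R N M P : Type*} [Ring R] [AddCommGroup N] [Module R N] [TopologicalSpace N]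
  [AddCommGroup M] [Module R M] [TopologicalSpace M] [AddCommGroup P] [Module R P]
  [TopologicalSpace P] {C : N →L[R] M} {D : N →L[R] P}

/-- The quotient `D C⁻¹`, that is, the operator `C z ↦ D z` on the range of `C`. It is only
meaningful for `ker C ≤ ker D`. -/
noncomputable def operatorQuotient (D : N →L[R] P) (C : N →L[R] M) : M →ₗ.[R] P :=
  (C.prod D).range.toLinearPMap

theorem mem_domain_operatorQuotient {x : M} :
    x ∈ (operatorQuotient D C).domain ↔ ∃ z, C z = x := by
  simp [operatorQuotient, Submodule.toLinearPMap_domain]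

theorem mem_graph_operatorQuotient (hC : Injective C) {x : M} {y : P} :
    (x, y) ∈ (operatorQuotient D C).graph ↔ ∃ z, C z = x ∧ D z = y := by
  rw [operatorQuotient, Submodule.toLinearPMap_graph_eq]
  · simp
  · rintro _ ⟨z, rfl⟩ hz
    obtain rfl : z = 0 := (map_eq_zero_iff C hC).1 hz
    exact map_zero D

theorem operatorQuotient_apply (hC : Injective C) {z : N} (x : (operatorQuotient D C).domain)
    (hz : C z = x) : operatorQuotient D C x = D z := by
  obtain ⟨w, hw, hDw⟩ := (mem_graph_operatorQuotient hC).1 ((operatorQuotient D C).mem_graph x)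
  rw [← hDw, hC (hw.trans hz.symm)]

theorem commute_apply {C D : M →L[R] M} (h : Commute C D) (x : M) : C (D x) = D (C x) :=
  congr($h.eq x)

end Ring

section SelfAdjoint

variable {𝕜 H : Type*} [RCLike 𝕜] [NormedAddCommGroup H] [InnerProductSpace 𝕜 H] [CompleteSpace H]
  {C D : H →L[𝕜] H}

theorem isSelfAdjoint_operatorQuotient (hinj : Injective C) (hC : IsSelfAdjoint C)
    (hD : IsSelfAdjoint D) (hCD : Commute C D) (hunit : IsUnit (C + D)) :
    IsSelfAdjoint (operatorQuotient D C) := by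
  have hdense : Dense ((operatorQuotient D C).domain : Set H) :=
    (denseRange_of_isSelfAdjoint_of_injective hC hinj).mono fun _ => mem_domain_operatorQuotient.2
  have mem_adjoint_iff (a b : H) : (a, b) ∈ (operatorQuotient D C).graph.adjoint ↔ D a = C b := by
    calc
      _ ↔ ∀ z, ⟪D z, a⟫_𝕜 - ⟪C z, b⟫_𝕜 = 0 := by
        simp only [Submodule.mem_adjoint_iff, mem_graph_operatorQuotient hinj]
        exact ⟨fun h z => h _ _ ⟨z, rfl, rfl⟩, by rintro h _ _ ⟨z, rfl, rfl⟩; exact h z⟩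
      _ ↔ ∀ z, ⟪z, D a⟫_𝕜 = ⟪z, C b⟫_𝕜 := forall_congr' fun z => by
        rw [sub_eq_zero, ← adjoint_inner_right, ← adjoint_inner_right, hC.adjoint_eq,
          hD.adjoint_eq]
      _ ↔ D a = C b := (ext_iff_inner_left 𝕜).symm
  rw [LinearPMap.isSelfAdjoint_def]
  refine LinearPMap.eq_of_eq_graph (Submodule.ext fun ⟨a, b⟩ => ?_)
  rw [LinearPMap.adjoint_graph_eq_graph_adjoint hdense, mem_adjoint_iff,
    mem_graph_operatorQuotient hinj]
  constructor
  · intro hab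
    obtain ⟨hsum_inj, hsum_surj⟩ := isUnit_iff_bijective.1 hunit
    obtain ⟨z, hz⟩ := hsum_surj (a + b)
    have hCz : C z = a := hsum_inj <| calc
      (C + D) (C z) = C ((C + D) z) :=
        commute_apply ((Commute.refl C).add_left hCD.symm) z
      _ = (C + D) a := by rw [hz, map_add, ← hab, add_apply]
    refine ⟨z, hCz, add_left_cancel (a := C z) (hz.trans ?_)⟩
    rw [hCz]
  · rintro ⟨z, rfl, rfl⟩
    exact (commute_apply hCD z).symm

theorem inner_apply_apply_eq_sub (hC : IsSelfAdjoint C) (hD : IsSelfAdjoint D)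
    (h : C * C + D * D = 1) (z w : H) : ⟪D z, D w⟫_𝕜 = ⟪z, w⟫_𝕜 - ⟪C z, C w⟫_𝕜 := by
  have mul_self_add : C (C w) + D (D w) = w := congr($h w)
  rw [← adjoint_inner_right, ← adjoint_inner_right, hC.adjoint_eq, hD.adjoint_eq,
    ← inner_sub_right, eq_sub_of_add_eq' mul_self_add]

end SelfAdjoint

variable {H : Type*} [NormedAddCommGroup H] [InnerProductSpace ℂ H]

theorem hasBoundedInverse_id_vadd_operatorQuotient {B : H →L[ℂ] H} (hB : Injective B) :
    ((LinearMap.id : H →ₗ[ℂ] H) +ᵥ operatorQuotient (1 - B) B).HasBoundedInverse B := by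
  have add_apply {x : (operatorQuotient (1 - B) B).domain} {z : H} (hz : B z = x) :
      (x : H) + operatorQuotient (1 - B) B x = z := by
    rw [operatorQuotient_apply hB x hz, ← hz]
    exact add_sub_cancel (B z) z
  refine ⟨fun x => ?_, fun y =>
    ⟨mem_domain_operatorQuotient.2 ⟨y, rfl⟩,
      add_apply (x := ⟨B y, mem_domain_operatorQuotient.2 ⟨y, rfl⟩⟩) rfl⟩⟩
  obtain ⟨z, hz⟩ := mem_domain_operatorQuotient.1 x.2
  exact (congrArg B (add_apply hz)).trans hz

variable [CompleteSpace H] {B C D : H →L[ℂ] H}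

theorem isPosSelfAdjoint_operatorQuotient (hinj : Injective C) (hC : 0 ≤ C) (hD : 0 ≤ D)
    (hCD : Commute C D) (hunit : IsUnit (C + D)) : (operatorQuotient D C).IsPosSelfAdjoint := by
  refine ⟨isSelfAdjoint_operatorQuotient hinj (.of_nonneg hC) (.of_nonneg hD) hCD hunit,
    fun x => ?_⟩
  obtain ⟨z, hz⟩ := mem_domain_operatorQuotient.1 x.2
  rw [operatorQuotient_apply hinj x hz, ← hz, ← adjoint_inner_right,
    (IsSelfAdjoint.of_nonneg hC).adjoint_eq]
  exact ((nonneg_iff_isPositive _).1 (hCD.mul_nonneg hC hD)).re_inner_nonneg_right z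

theorem isPosSelfAdjoint_operatorQuotient_one_sub (hinj : Injective B) (hB₀ : 0 ≤ B)
    (hB₁ : B ≤ 1) : (operatorQuotient (1 - B) B).IsPosSelfAdjoint :=
  isPosSelfAdjoint_operatorQuotient hinj hB₀ (sub_nonneg.2 hB₁)
    ((Commute.one_right B).sub_right (Commute.refl B)) (by simp)

theorem isPosSqrtOf_operatorQuotient (hinj : Injective C) (hC : 0 ≤ C) (hD : 0 ≤ D)
    (hCD : Commute C D) (h : C * C + D * D = 1) :
    (operatorQuotient D C).IsPosSqrtOf (operatorQuotient (D * D) (C * C)) := by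
  refine ⟨isPosSelfAdjoint_operatorQuotient hinj hC hD hCD
    (isUnit_add_of_mul_self_add_mul_self_eq_one hC hD hCD h), fun x y => ?_⟩
  have hinj₂ : Injective ⇑(C * C) := hinj.comp hinj
  have mul_self_add (x : H) : C (C x) + D (D x) = x := congr($h x)
  simp only [mem_graph_operatorQuotient hinj, mem_graph_operatorQuotient hinj₂]
  constructor
  · rintro ⟨z, rfl, rfl⟩
    exact ⟨D (C z), ⟨C z, rfl, rfl⟩, D z, commute_apply hCD z, rfl⟩
  · rintro ⟨_, ⟨z, rfl, rfl⟩, v, hv, rfl⟩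
    have hCz : C (C z + D v) = z := by rw [map_add, commute_apply hCD, hv, mul_self_add]
    have hDv : D (C z + D v) = v := by rw [map_add, ← commute_apply hCD, ← hv, mul_self_add]
    exact ⟨C z + D v, congrArg C hCz, congrArg D hDv⟩

end OperatorQuotient

namespace PosForm

section Order

variable {H : Type*} [NormedAddCommGroup H] [InnerProductSpace ℂ H] {p q r : PosForm H}

/-- The identity from the form domain to its type synonym `FormSpace`, which carries the inner
product `⟪x, y⟫ + q (x, y)`. -/
def toFormSpace (q : PosForm H) : q.domain ≃ₗ[ℂ] q.FormSpace :=
  LinearEquiv.refl ℂ q.domain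

theorem inclusion_mem_domain (q : PosForm H) (u : q.FormSpace) : q.inclusion u ∈ q.domain :=
  (q.toFormSpace.symm u).2

theorem inclusion_injective (q : PosForm H) : Injective q.inclusion :=
  Subtype.val_injective

theorem norm_toFormSpace_sq (q : PosForm H) (x : q.domain) :
    ‖q.toFormSpace x‖ ^ 2 = ‖(x : H)‖ ^ 2 + (q.form x x).re := by
  rw [← inner_self_eq_norm_sq (𝕜 := ℂ), ← inner_self_eq_norm_sq (𝕜 := ℂ)]
  rfl

theorem le_of_contraction (W : q.FormSpace → p.FormSpace) (hW : ∀ u, ‖W u‖ ≤ ‖u‖)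
    (hincl : ∀ u, p.inclusion (W u) = q.inclusion u) : p ≤ q := by
  have hdom : q.domain ≤ p.domain := fun x hx => by
    have hWx : p.inclusion (W (q.toFormSpace ⟨x, hx⟩)) = x := hincl _
    exact hWx ▸ p.inclusion_mem_domain _
  refine ⟨hdom, fun x => ?_⟩
  have hWx : W (q.toFormSpace x) = p.toFormSpace ⟨x, hdom x.2⟩ := p.inclusion_injective (hincl _)
  have hnorm := pow_le_pow_left₀ (norm_nonneg _) (hW (q.toFormSpace x)) 2
  rw [hWx, norm_toFormSpace_sq, norm_toFormSpace_sq] at hnorm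
  exact le_of_add_le_add_left hnorm

theorem norm_toFormSpace_le (h : p ≤ q) (x : q.domain) :
    ‖p.toFormSpace ⟨x, h.1 x.2⟩‖ ≤ ‖q.toFormSpace x‖ := by
  refine le_of_sq_le_sq ?_ (norm_nonneg _)
  rw [norm_toFormSpace_sq, norm_toFormSpace_sq]
  exact add_le_add_right (h.2 x) _

/-- The inclusion `Dom q ⊆ Dom p` for `p ≤ q`, as a bounded operator between the form spaces. -/
noncomputable def inclusionOfLE (h : p ≤ q) : q.FormSpace →L[ℂ] p.FormSpace :=
  LinearMap.mkContinuous
    (p.toFormSpace ∘ₗ Submodule.inclusion h.1 ∘ₗ q.toFormSpace.symm.toLinearMap) 1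
    fun x => (norm_toFormSpace_le h x).trans_eq (one_mul _).symm

theorem inclusionOfLE_toFormSpace (h : p ≤ q) (x : q.domain) :
    inclusionOfLE h (q.toFormSpace x) = p.toFormSpace ⟨x, h.1 x.2⟩ := rfl

theorem inclusion_inclusionOfLE (h : p ≤ q) (u : q.FormSpace) :
    p.inclusion (inclusionOfLE h u) = q.inclusion u := rfl

theorem norm_inclusionOfLE_apply_le (h : p ≤ q) (u : q.FormSpace) : ‖inclusionOfLE h u‖ ≤ ‖u‖ :=
  norm_toFormSpace_le h (q.toFormSpace.symm u)

theorem isExtension_of_norm_inclusionOfLE (h : p ≤ q)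
    (hnorm : ∀ u, ‖inclusionOfLE h u‖ = ‖u‖) : p.IsExtension q := by
  refine ⟨h.1, fun x y => ?_⟩
  let V : q.FormSpace →ₗᵢ[ℂ] p.FormSpace := ⟨inclusionOfLE h, hnorm⟩
  exact add_left_cancel (V.inner_map_map (q.toFormSpace x) (q.toFormSpace y))

theorem IsExtension.le (h : p.IsExtension q) : p ≤ q :=
  ⟨h.1, fun x => (congrArg Complex.re (h.2 x x)).le⟩

theorem IsExtension.norm_inclusionOfLE (h : p.IsExtension q) (u : q.FormSpace) :
    ‖inclusionOfLE h.le u‖ = ‖u‖ := by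
  obtain ⟨x, rfl⟩ := q.toFormSpace.surjective u
  rw [inclusionOfLE_toFormSpace, ← sq_eq_sq₀ (norm_nonneg _) (norm_nonneg _),
    norm_toFormSpace_sq, norm_toFormSpace_sq, h.2 x x]

theorem IsExtension.antisymm (h : p.IsExtension q) (h' : q.IsExtension p) : p = q := by
  obtain ⟨hdom, hform⟩ := h
  obtain ⟨D, _, f, _, _⟩ := p
  obtain ⟨D', _, g, _, _⟩ := q
  obtain rfl : D = D' := le_antisymm h'.1 hdom
  obtain rfl : f = g := LinearMap.ext₂ hform
  rfl

instance : PartialOrder (PosForm H) where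
  le_refl _ := ⟨le_rfl, fun _ => le_rfl⟩
  le_trans _ _ _ h h' := ⟨h'.1.trans h.1, fun x => (h.2 ⟨x, h'.1 x.2⟩).trans (h'.2 x)⟩
  le_antisymm p q hpq hqp := by
    -- Mutually inverse contractions are isometries, so `p` and `q` extend each other.
    have hnorm {p q : PosForm H} (hpq : p ≤ q) (hqp : q ≤ p) (u : q.FormSpace) :
        ‖inclusionOfLE hpq u‖ = ‖u‖ :=
      (norm_inclusionOfLE_apply_le hpq u).antisymm
        (norm_inclusionOfLE_apply_le hqp (inclusionOfLE hpq u))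
    exact (isExtension_of_norm_inclusionOfLE hpq (hnorm hpq hqp)).antisymm
      (isExtension_of_norm_inclusionOfLE hqp (hnorm hqp hpq))

theorem IsACPartOf.unique (hp : p.IsACPartOf r) (hq : q.IsACPartOf r) : p = q :=
  IsGreatest.unique hp hq

theorem IsClosureOf.unique (hp : p.IsClosureOf r) (hq : q.IsClosureOf r) : p = q :=
  (hq.2.2 p hp.1 hp.2.1).antisymm (hp.2.2 q hq.1 hq.2.1)

/-- `hcore` says that `Dom q` is a core of `p`. -/
theorem IsExtension.of_le_of_denseRange (hr : r.IsExtension q) (hp : p.IsExtension q) (h : r ≤ p)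
    (hcore : DenseRange (inclusionOfLE hp.le)) : r.IsExtension p := by
  refine isExtension_of_norm_inclusionOfLE h fun u => ?_
  refine hcore.induction_on u (isClosed_eq (by fun_prop) continuous_norm) fun x => ?_
  exact (hr.norm_inclusionOfLE x).trans (hp.norm_inclusionOfLE x).symm

/-- The restriction of a form to a smaller dense domain. -/
noncomputable def restrict (p : PosForm H) (D : Submodule ℂ H) (hdense : Dense (D : Set H))
    (hle : D ≤ p.domain) : PosForm H where
  domain := D
  dense := hdense
  form := (p.form.comp (Submodule.inclusion hle)).compl₂ (Submodule.inclusion hle)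
  im_self x := p.im_self (Submodule.inclusion hle x)
  re_self_nonneg x := p.re_self_nonneg (Submodule.inclusion hle x)

theorem isExtension_restrict (p : PosForm H) {D : Submodule ℂ H} (hdense : Dense (D : Set H))
    (hle : D ≤ p.domain) : p.IsExtension (p.restrict D hdense hle) :=
  ⟨hle, fun _ _ => rfl⟩

end Order

section RangeForm

variable {H K : Type*} [NormedAddCommGroup H] [InnerProductSpace ℂ H]
  [NormedAddCommGroup K] [InnerProductSpace ℂ K]

/-- The form `⟪J⁻¹ x, J⁻¹ y⟫ - ⟪x, y⟫` on the range of an injective contraction `J : K → H` with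
dense range. Its form space is a copy of `K`, in which `J` becomes the inclusion of the form
domain. -/
noncomputable def rangeForm (J : K →L[ℂ] H) (hinj : Injective J) (hdense : DenseRange J)
    (hnorm : ‖J‖ ≤ 1) : PosForm H :=
  let L := (LinearEquiv.ofInjective (J : K →ₗ[ℂ] H) hinj).symm.toLinearMap
  have apply_L (x : J.range) : J (L x) = x :=
    congrArg Subtype.val ((LinearEquiv.ofInjective (J : K →ₗ[ℂ] H) hinj).apply_symm_apply x)
  { domain := J.range
    dense := hdense
    form := ((innerₛₗ ℂ).comp L).compl₂ L -
      ((innerₛₗ ℂ).comp J.range.subtype).compl₂ J.range.subtype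
    im_self x := by
      change (⟪L x, L x⟫_ℂ - ⟪(x : H), (x : H)⟫_ℂ).im = 0
      rw [Complex.sub_im, ← RCLike.im_eq_complex_im, inner_self_im, inner_self_im, sub_zero]
    re_self_nonneg x := by
      change 0 ≤ (⟪L x, L x⟫_ℂ - ⟪(x : H), (x : H)⟫_ℂ).re
      rw [Complex.sub_re, ← RCLike.re_eq_complex_re, inner_self_eq_norm_sq,
        inner_self_eq_norm_sq, sub_nonneg, ← apply_L x]
      gcongr
      exact J.le_of_opNorm_le_of_le hnorm le_rfl |>.trans_eq (one_mul _) }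

variable {J : K →L[ℂ] H} {hinj : Injective J} {hdense : DenseRange J} {hnorm : ‖J‖ ≤ 1}

theorem mem_domain_rangeForm {x : H} :
    x ∈ (rangeForm J hinj hdense hnorm).domain ↔ ∃ z, J z = x := Iff.rfl

theorem rangeForm_form {z w : K} {x y : (rangeForm J hinj hdense hnorm).domain} (hx : J z = x)
    (hy : J w = y) :
    (rangeForm J hinj hdense hnorm).form x y = ⟪z, w⟫_ℂ - ⟪J z, J w⟫_ℂ := by
  obtain rfl : x = ⟨J z, z, rfl⟩ := Subtype.ext hx.symm
  obtain rfl : y = ⟨J w, w, rfl⟩ := Subtype.ext hy.symm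
  have symm_apply (v : K) :
      (LinearEquiv.ofInjective (J : K →ₗ[ℂ] H) hinj).symm ⟨J v, v, rfl⟩ = v :=
    (LinearEquiv.ofInjective (J : K →ₗ[ℂ] H) hinj).symm_apply_apply v
  exact congrArg₂ (fun a b => ⟪a, b⟫_ℂ - ⟪J z, J w⟫_ℂ) (symm_apply z) (symm_apply w)

variable (J hinj hdense hnorm) in
/-- `J`, as a unitary from `K` onto the form space of `rangeForm J`. -/
noncomputable def rangeFormIsometryEquiv :
    K ≃ₗᵢ[ℂ] (rangeForm J hinj hdense hnorm).FormSpace :=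
  LinearEquiv.isometryOfInner
    ((LinearEquiv.ofInjective (J : K →ₗ[ℂ] H) hinj).trans
      (rangeForm J hinj hdense hnorm).toFormSpace)
    fun z w => (congrArg (⟪J z, J w⟫_ℂ + ·) (rangeForm_form rfl rfl)).trans (add_sub_cancel _ _)

theorem inclusion_rangeFormIsometryEquiv (z : K) :
    inclusion _ (rangeFormIsometryEquiv J hinj hdense hnorm z) = J z := rfl

theorem apply_symm_rangeFormIsometryEquiv (u : (rangeForm J hinj hdense hnorm).FormSpace) :
    J ((rangeFormIsometryEquiv J hinj hdense hnorm).symm u) = inclusion _ u := by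
  rw [← inclusion_rangeFormIsometryEquiv, LinearIsometryEquiv.apply_symm_apply]

theorem isClosed_rangeForm [CompleteSpace K] : (rangeForm J hinj hdense hnorm).IsClosed :=
  (rangeFormIsometryEquiv J hinj hdense hnorm).symm.toIsometryEquiv.completeSpace

end RangeForm

section Representation

variable {H K : Type*} [NormedAddCommGroup H] [InnerProductSpace ℂ H] [CompleteSpace H]
  [NormedAddCommGroup K] [InnerProductSpace ℂ K] [CompleteSpace K]

theorem isFormOf_rangeForm {J : K →L[ℂ] H} (hinj : Injective J) (hdense : DenseRange J)
    (hnorm : ‖J‖ ≤ 1) :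
    (rangeForm J hinj hdense hnorm).IsFormOf
      (operatorQuotient (1 - J ∘L J†) (J ∘L J†)) := by
  have hB := injective_self_comp_adjoint hdense
  have hB₀ := self_comp_adjoint_nonneg J
  have hB₁ := self_comp_adjoint_le_one hnorm
  have hCD := commute_sqrt_sqrt_one_sub (J ∘L J†)
  have hCC := CFC.sqrt_mul_sqrt_self _ hB₀
  have hDD := CFC.sqrt_mul_sqrt_self _ (sub_nonneg.2 hB₁)
  have hC₀ := CFC.sqrt_nonneg (J ∘L J†)
  have hD₀ := CFC.sqrt_nonneg (1 - J ∘L J†)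
  generalize CFC.sqrt (J ∘L J†) = C, CFC.sqrt (1 - J ∘L J†) = D at *
  have hC : Injective C := .of_comp (f := C) (hCC ▸ hB : Injective ⇑(C * C))
  have hsum : C * C + D * D = 1 := by rw [hCC, hDD, add_sub_cancel]
  have hsqrt := isPosSqrtOf_operatorQuotient hC hC₀ hD₀ hCD hsum
  rw [hCC, hDD] at hsqrt
  obtain ⟨U, hU⟩ := exists_linearIsometryEquiv_comp_eq hinj hdense (.of_nonneg hC₀) hCC
  refine ⟨isPosSelfAdjoint_operatorQuotient_one_sub hB hB₀ hB₁, operatorQuotient D C, hsqrt, ?_,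
    fun x y => ?_⟩
  · ext x
    rw [mem_domain_operatorQuotient, mem_domain_rangeForm, U.surjective.exists]
    simp only [hU]
  · obtain ⟨z, hz⟩ := U.surjective.exists.1 (mem_domain_rangeForm.1 x.2)
    obtain ⟨w, hw⟩ := U.surjective.exists.1 (mem_domain_rangeForm.1 y.2)
    rw [rangeForm_form hz hw, U.inner_map_map, hU, hU,
      ← inner_apply_apply_eq_sub (.of_nonneg hC₀) (.of_nonneg hD₀) hsum,
      operatorQuotient_apply hC _ ((hU z).symm.trans hz),
      operatorQuotient_apply hC _ ((hU w).symm.trans hw)]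

end Representation

section ClosedPart

variable {H : Type*} [NormedAddCommGroup H] [InnerProductSpace ℂ H] [CompleteSpace H]
  {q s : PosForm H}

theorem norm_coEmbedding_le (q : PosForm H) : ‖q.coEmbedding‖ ≤ 1 := by
  refine opNorm_le_bound _ zero_le_one fun u => ?_
  refine Completion.induction_on u (isClosed_le (by fun_prop) (by fun_prop)) fun x => ?_
  rw [Completion.norm_coe]
  exact (congrArg norm (q.coEmbedding_embed x)).trans_le (q.norm_inclusionₗ_le x)

theorem denseRange_coEmbedding (q : PosForm H) : DenseRange q.coEmbedding :=
  q.dense.mono fun x hx => ⟨q.embed ⟨x, hx⟩, q.coEmbedding_embed ⟨x, hx⟩⟩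

/-- The quotient norm of `Ĥ(q) / ker E_q`, as a form on the range of the co-embedding `E_q`: the
closure of the absolutely continuous part of `q`. -/
noncomputable def closedPart (q : PosForm H) : PosForm H :=
  rangeForm (injectivePart q.coEmbedding) (injective_injectivePart _)
    (denseRange_injectivePart q.denseRange_coEmbedding)
    ((norm_injectivePart_le _).trans q.norm_coEmbedding_le)

/-- The unitary from `(ker E_q)ᗮ` onto the form space of `q.closedPart`. -/
noncomputable def closedPartIsometryEquiv (q : PosForm H) :
    q.coEmbedding.kerᗮ ≃ₗᵢ[ℂ] q.closedPart.FormSpace :=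
  rangeFormIsometryEquiv _ _ _ _

theorem coEmbedding_symm_closedPartIsometryEquiv (q : PosForm H) (u : q.closedPart.FormSpace) :
    q.coEmbedding (q.closedPartIsometryEquiv.symm u) = q.closedPart.inclusion u :=
  apply_symm_rangeFormIsometryEquiv u

/-- The quotient map from `Ĥ(q)` to the form space of `q.closedPart`. -/
noncomputable def toClosedPart (q : PosForm H) (u : q.FormCompletion) : q.closedPart.FormSpace :=
  q.closedPartIsometryEquiv (q.coEmbedding.kerᗮ.orthogonalProjectionOnto u)

theorem inclusion_toClosedPart (q : PosForm H) (u : q.FormCompletion) :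
    q.closedPart.inclusion (q.toClosedPart u) = q.coEmbedding u :=
  injectivePart_orthogonalProjectionOnto _ u

theorem norm_toClosedPart_le (q : PosForm H) (u : q.FormCompletion) : ‖q.toClosedPart u‖ ≤ ‖u‖ :=
  (q.closedPartIsometryEquiv.norm_map _).trans_le
    (Submodule.norm_orthogonalProjectionOnto_apply_le _ u)

theorem denseRange_toClosedPart_coe (q : PosForm H) :
    DenseRange fun u : q.FormSpace => q.toClosedPart u := by
  have hsurj : Surjective q.toClosedPart :=
    q.closedPartIsometryEquiv.surjective.comp fun v =>
      ⟨v, Submodule.orthogonalProjectionOnto_mem_subspace_eq_self v⟩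
  have hcont : Continuous q.toClosedPart :=
    q.closedPartIsometryEquiv.continuous.comp (ContinuousLinearMap.continuous _)
  exact hsurj.denseRange.comp Completion.denseRange_coe hcont

theorem closedPart_le (q : PosForm H) : q.closedPart ≤ q :=
  le_of_contraction (fun u => q.toClosedPart u)
    (fun u => (q.norm_toClosedPart_le u).trans_eq (Completion.norm_coe u))
    fun u => (q.inclusion_toClosedPart u).trans (q.coEmbedding_embed u)

theorem exists_contraction_of_le (hs : s.IsClosed) (h : s ≤ q) :
    ∃ W : q.FormCompletion →L[ℂ] s.FormSpace,
      (∀ u, ‖W u‖ ≤ ‖u‖) ∧ ∀ u, s.inclusion (W u) = q.coEmbedding u := by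
  have : CompleteSpace s.FormSpace := hs
  have extend_coe (x : q.FormSpace) :
      (inclusionOfLE h).extend Completion.toComplL (x : q.FormCompletion) = inclusionOfLE h x :=
    extend_eq _ Completion.denseRange_coe (Completion.isUniformInducing_coe _) x
  refine ⟨(inclusionOfLE h).extend Completion.toComplL, fun u => ?_, fun u => ?_⟩
  · refine Completion.induction_on u (isClosed_le (by fun_prop) (by fun_prop)) fun x => ?_
    rw [extend_coe, Completion.norm_coe]
    exact norm_inclusionOfLE_apply_le h x
  · refine Completion.induction_on u (isClosed_eq (by fun_prop) (by fun_prop)) fun x => ?_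
    rw [extend_coe, inclusion_inclusionOfLE]
    exact (q.coEmbedding_embed x).symm

theorem isGreatest_closedPart (q : PosForm H) :
    IsGreatest {s : PosForm H | s.IsClosed ∧ s ≤ q} q.closedPart := by
  refine ⟨⟨isClosed_rangeForm, q.closedPart_le⟩, fun s ⟨hs, hsq⟩ => ?_⟩
  obtain ⟨W, hW, hWE⟩ := exists_contraction_of_le hs hsq
  refine le_of_contraction (fun u => W (q.closedPartIsometryEquiv.symm u))
    (fun u => (hW _).trans_eq (q.closedPartIsometryEquiv.symm.norm_map u)) fun u => ?_
  exact (hWE _).trans (q.coEmbedding_symm_closedPartIsometryEquiv u)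

/-- The absolutely continuous part of `q`. -/
noncomputable def acPart (q : PosForm H) : PosForm H :=
  q.closedPart.restrict q.domain q.dense q.closedPart_le.1

theorem isExtension_acPart (q : PosForm H) : q.closedPart.IsExtension q.acPart :=
  q.closedPart.isExtension_restrict q.dense q.closedPart_le.1

theorem acPart_le (q : PosForm H) : q.acPart ≤ q :=
  ⟨le_rfl, q.closedPart_le.2⟩

theorem isACPartOf_acPart (q : PosForm H) : q.acPart.IsACPartOf q := by
  refine ⟨⟨⟨q.closedPart, q.isGreatest_closedPart.1.1, q.isExtension_acPart⟩, q.acPart_le⟩, ?_⟩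
  rintro r ⟨⟨s, hs, hsr⟩, hrq⟩
  have hle : s ≤ q.closedPart := q.isGreatest_closedPart.2 ⟨hs, hsr.le.trans hrq⟩
  refine ⟨hrq.1, fun x => ?_⟩
  calc
    (r.form ⟨x, hrq.1 x.2⟩ ⟨x, hrq.1 x.2⟩).re = _ := congrArg Complex.re (hsr.2 _ _).symm
    _ ≤ (q.acPart.form x x).re := hle.2 ⟨x, q.closedPart_le.1 x.2⟩

theorem denseRange_inclusionOfLE_acPart (q : PosForm H) :
    DenseRange (inclusionOfLE q.isExtension_acPart.le) := by
  refine q.denseRange_toClosedPart_coe.mono ?_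
  rintro _ ⟨u, rfl⟩
  refine ⟨q.acPart.toFormSpace (q.toFormSpace.symm u), q.closedPart.inclusion_injective ?_⟩
  exact (q.coEmbedding_embed u).symm.trans (q.inclusion_toClosedPart u).symm

theorem isClosureOf_closedPart (q : PosForm H) : q.closedPart.IsClosureOf q.acPart := by
  refine ⟨q.isGreatest_closedPart.1.1, q.isExtension_acPart, fun r hr hext => ?_⟩
  have hle : r ≤ q.closedPart := q.isGreatest_closedPart.2 ⟨hr, hext.le.trans q.acPart_le⟩
  exact hext.of_le_of_denseRange q.isExtension_acPart hle q.denseRange_inclusionOfLE_acPart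

theorem isFormOf_closedPart (q : PosForm H) :
    q.closedPart.IsFormOf (operatorQuotient (1 - q.coEmbedding ∘L q.coEmbedding†)
      (q.coEmbedding ∘L q.coEmbedding†)) := by
  rw [← injectivePart_comp_adjoint]
  exact isFormOf_rangeForm _ _ _

end ClosedPart

section Uniqueness

variable {H : Type*} [NormedAddCommGroup H] [InnerProductSpace ℂ H] [CompleteSpace H]
  {q : PosForm H} {T T' : H →ₗ.[ℂ] H}

theorem IsFormOf.mem_graph_iff (h : q.IsFormOf T) {x y : H} :
    (x, y) ∈ T.graph ↔
      ∃ hx : x ∈ q.domain, ∀ z : q.domain, q.form z ⟨x, hx⟩ = ⟪(z : H), y⟫_ℂ := by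
  obtain ⟨-, S, ⟨⟨hS, -⟩, hST⟩, hdom, hform⟩ := h
  rw [hST]
  constructor
  · rintro ⟨w, hxw, hwy⟩
    obtain ⟨x, rfl, rfl⟩ := S.mem_graph_iff.1 hxw
    refine ⟨hdom.ge x.2, fun z => ?_⟩
    exact (hform _ _).trans ((mem_graph_iff_of_isSelfAdjoint hS).1 hwy ⟨z, hdom.le z.2⟩)
  · rintro ⟨hx, h⟩
    refine ⟨_, S.mem_graph ⟨x, hdom.le hx⟩, (mem_graph_iff_of_isSelfAdjoint hS).2 fun z => ?_⟩
    exact (hform ⟨z, hdom.ge z.2⟩ ⟨x, hx⟩).symm.trans (h _)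

theorem IsFormOf.unique (h : q.IsFormOf T) (h' : q.IsFormOf T') : T = T' :=
  LinearPMap.eq_of_eq_graph <| Submodule.ext fun _ => h.mem_graph_iff.trans h'.mem_graph_iff.symm

end Uniqueness

end PosForm

theorem theorem4p7_general {H : Type*} [NormedAddCommGroup H] [InnerProductSpace ℂ H]
    [CompleteSpace H] (q : PosForm H) :
    (∃! T : H →ₗ.[ℂ] H, ∃ qac qT : PosForm H,
      qac.IsACPartOf q ∧ qT.IsClosureOf qac ∧ qT.IsFormOf T) ∧
    ‖q.coEmbedding‖ ≤ 1 ∧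
    ∀ (qac qT : PosForm H) (T : H →ₗ.[ℂ] H),
      qac.IsACPartOf q → qT.IsClosureOf qac → qT.IsFormOf T →
        ((LinearMap.id : H →ₗ[ℂ] H) +ᵥ T).HasBoundedInverse
          (q.coEmbedding ∘L q.coEmbedding†) := by
  have eq_operatorQuotient {qac qT : PosForm H} {T : H →ₗ.[ℂ] H} (hac : qac.IsACPartOf q)
      (hcl : qT.IsClosureOf qac) (hT : qT.IsFormOf T) :
      T = operatorQuotient (1 - q.coEmbedding ∘L q.coEmbedding†)
        (q.coEmbedding ∘L q.coEmbedding†) := by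
    obtain rfl := hac.unique q.isACPartOf_acPart
    obtain rfl := hcl.unique q.isClosureOf_closedPart
    exact hT.unique q.isFormOf_closedPart
  refine ⟨⟨_, ⟨q.acPart, q.closedPart, q.isACPartOf_acPart, q.isClosureOf_closedPart,
    q.isFormOf_closedPart⟩, ?_⟩, q.norm_coEmbedding_le, ?_⟩
  · rintro T ⟨_, _, hac, hcl, hT⟩
    exact eq_operatorQuotient hac hcl hT
  · intro _ _ _ hac hcl hT
    rw [eq_operatorQuotient hac hcl hT]
    exact hasBoundedInverse_id_vadd_operatorQuotient
      (injective_self_comp_adjoint q.denseRange_coEmbedding)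

theorem theorem4p7 {H : Type*} [NormedAddCommGroup H] [InnerProductSpace ℂ H] [CompleteSpace H]
    [TopologicalSpace.SeparableSpace H] (q : PosForm H) :
    -- the operator `T` whose form is the closure of the absolutely continuous part exists ...
    (∃! T : H →ₗ.[ℂ] H, ∃ qac qT : PosForm H,
      qac.IsACPartOf q ∧ qT.IsClosureOf qac ∧ qT.IsFormOf T) ∧
    -- ... the co-embedding is contractive, and `(I + T)⁻¹ = E_q E_q*`
    ‖q.coEmbedding‖ ≤ 1 ∧
    ∀ (qac qT : PosForm H) (T : H →ₗ.[ℂ] H),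
      qac.IsACPartOf q → qT.IsClosureOf qac → qT.IsFormOf T →
        ((LinearMap.id : H →ₗ[ℂ] H) +ᵥ T).HasBoundedInverse
          (q.coEmbedding ∘L ContinuousLinearMap.adjoint q.coEmbedding) :=
  theorem4p7_general q
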